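/- Let $K=\mathbb{R}$ or $K=\mathbb{C}$, let $(\Omega,\mathcal F,P)$ be a probability space and let $n$ be a positive integer. Let $L^0(\mathcal F,K)$ be the algebra of $P$-almost sure equivalence classes of $K$-valued random variables on $(\Omega,\mathcal F,P)$, and let $L^0(\mathcal F,K^n)$ be the $L^0(\mathcal F,K)$-module of equivalence classes of $K^n$-valued random variables, with the module multiplication $\lambda\cdot(\xi_1,\dots,\xi_n)=(\lambda\xi_1,\dots,\lambda\xi_n)$. For $x=(\xi_1,\dots,\xi_n)$ and $y=(\eta_1,\dots,\eta_n)$ in $L^0(\mathcal F,K^n)$ put $\langle x,y\rangle=\sum_{i=1}^n\xi_i\overline{\eta_i}\in L^0(\mathcal F,K)$. For $A\in\mathcal F$ let $\tilde I_A\in L^0(\mathcal F,K)$ be the equivalence class of the characteristic function of $A$. A subset $G$ of $L^0(\mathcal F,K^n)$ has the countable concatenation property if for every sequence $(A_k)_{k\in\mathbb N}$ of pairwise disjoint sets in $\mathcal F$ with $\bigcup_k A_k=\Omega$ and every sequence $(x_k)_{k\in\mathbb N}$ in $G$ there is $z\in G$ with $\tilde I_{A_k}z=\tilde I_{A_k}x_k$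 for all $k\in\mathbb N$. Let $M$ be an $L^0(\mathcal F,K)$-submodule of $L^0(\mathcal F,K^n)$ such that $M\neq L^0(\mathcal F,K^n)$ and $M$ has the countable concatenation property. Then there exists $x\in L^0(\mathcal F,K^n)$ such that $x\neq 0$ and $\langle x,y\rangle=0$ for all $y\in M$. -/

import Mathlib

open MeasureTheory

noncomputable section

namespace RandomModule

/-- `L⁰(𝓕, K)`: the algebra of equivalence classes of `K`-valued random variables. -/
abbrev L0 {Ω : Type*} [MeasurableSpace Ω] (P : Measure Ω) (K : Type*) [RCLike K] : Type _ :=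
  Ω →ₘ[P] K

/-- `L⁰(𝓕, Kⁿ)`: the equivalence classes of `Kⁿ`-valued random variables. -/
abbrev L0Vec {Ω : Type*} [MeasurableSpace Ω] (P : Measure Ω) (K : Type*) [RCLike K] (n : ℕ) :
    Type _ :=
  Ω →ₘ[P] EuclideanSpace K (Fin n)

section

variable {Ω : Type*} [MeasurableSpace Ω] {P : Measure Ω} {K : Type*} [RCLike K] {n : ℕ}

/-- The pointwise ring structure on `L⁰(𝓕, K)`, extending Mathlib's additive group and
multiplicative monoid structures on it. -/
instance : CommRing (L0 P K) :=
  { (inferInstance : AddCommGroup (L0 P K)), (inferInstance : CommMonoid (L0 P K)) with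
    left_distrib := fun a b c => AEEqFun.toGerm_injective (by
      simp only [AEEqFun.mul_toGerm, AEEqFun.add_toGerm, mul_add])
    right_distrib := fun a b c => AEEqFun.toGerm_injective (by
      simp only [AEEqFun.mul_toGerm, AEEqFun.add_toGerm, add_mul])
    zero_mul := fun a => AEEqFun.toGerm_injective (by
      simp only [AEEqFun.mul_toGerm, AEEqFun.zero_toGerm, zero_mul])
    mul_zero := fun a => AEEqFun.toGerm_injective (by
      simp only [AEEqFun.mul_toGerm, AEEqFun.zero_toGerm, mul_zero]) }

/-- The module multiplication of `L⁰(𝓕, K)` on `L⁰(𝓕, Kⁿ)`, induced by the pointwise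
(coordinatewise) multiplication of representatives. -/
instance : SMul (L0 P K) (L0Vec P K n) :=
  ⟨fun c x => AEEqFun.comp₂ (fun (a : K) (v : EuclideanSpace K (Fin n)) => a • v)
    continuous_smul c x⟩

theorem smul_mk_mk (f : Ω → K) (hf : AEStronglyMeasurable f P)
    (g : Ω → EuclideanSpace K (Fin n)) (hg : AEStronglyMeasurable g P) :
    (AEEqFun.mk f hf : L0 P K) • (AEEqFun.mk g hg : L0Vec P K n)
      = AEEqFun.mk (fun ω => f ω • g ω) (hf.smul hg) :=
  rfl

instance : Module (L0 P K) (L0Vec P K n) where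
  one_smul x := by
    induction x using AEEqFun.induction_on with
    | _ g hg =>
      rw [AEEqFun.one_def, smul_mk_mk]
      simp
  mul_smul c d x := by
    induction c using AEEqFun.induction_on with
    | _ f hf =>
    induction d using AEEqFun.induction_on with
    | _ f' hf' =>
    induction x using AEEqFun.induction_on with
    | _ g hg =>
      simp only [AEEqFun.mk_mul_mk, smul_mk_mk, Pi.mul_apply, mul_smul]
  smul_zero c := by
    induction c using AEEqFun.induction_on with
    | _ f hf =>
      rw [AEEqFun.zero_def, smul_mk_mk]
      simp
  smul_add c x y := by
    induction c using AEEqFun.induction_on with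
    | _ f hf =>
    induction x using AEEqFun.induction_on with
    | _ g hg =>
    induction y using AEEqFun.induction_on with
    | _ g' hg' =>
      simp only [AEEqFun.mk_add_mk, smul_mk_mk, Pi.add_apply, smul_add]
      rfl
  add_smul c d x := by
    induction c using AEEqFun.induction_on with
    | _ f hf =>
    induction d using AEEqFun.induction_on with
    | _ f' hf' =>
    induction x using AEEqFun.induction_on with
    | _ g hg =>
      simp only [AEEqFun.mk_add_mk, smul_mk_mk, Pi.add_apply, add_smul]
      rfl
  zero_smul x := by
    induction x using AEEqFun.induction_on with
    | _ g hg =>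
      rw [AEEqFun.zero_def, smul_mk_mk]
      simp only [zero_smul]
      rfl

/-- The `L⁰`-valued inner product `⟨x, y⟩ = ∑ i, ξᵢ * conj ηᵢ` on `L⁰(𝓕, Kⁿ)`. -/
def innerL0 (x y : L0Vec P K n) : L0 P K :=
  AEEqFun.comp₂
    (fun v w : EuclideanSpace K (Fin n) => ∑ i, v i * (starRingEnd K) (w i))
    (by
      simp only [Function.uncurry_def]
      have h := RCLike.continuous_conj (K := K)
      fun_prop) x y

/-- The equivalence class in `L⁰(𝓕, K)` of the characteristic function of `A`. -/
def indL0 (P : Measure Ω) (K : Type*) [RCLike K] (A : Set Ω) (hA : MeasurableSet A) : L0 P K :=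
  AEEqFun.mk (A.indicator fun _ => (1 : K))
    (stronglyMeasurable_const.indicator hA).aestronglyMeasurable

/-- A subset `G` of an `L⁰(𝓕, K)`-module has the countable concatenation property: for every
countable measurable partition `(A k)` of `Ω` and every sequence `(x k)` in `G` there is `z ∈ G`
which is the concatenation of the `x k` along the `A k`. -/
def HasCountableConcatenation {E : Type*} [AddCommGroup E] [Module (L0 P K) E]
    (G : Set E) : Prop :=
  ∀ (A : ℕ → Set Ω) (hA : ∀ k, MeasurableSet (A k)),
    Pairwise (fun i j => Disjoint (A i) (A j)) → (⋃ k, A k) = Set.univ →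
    ∀ x : ℕ → E, (∀ k, x k ∈ G) →
      ∃ z ∈ G, ∀ k, indL0 P K (A k) (hA k) • z = indL0 P K (A k) (hA k) • x k

end

end RandomModule

end

open scoped InnerProductSpace

namespace RandomModule

variable {Ω : Type*} [MeasurableSpace Ω] {P : Measure Ω} {K : Type*} [RCLike K] {n : ℕ}

/-! Fix `v ∉ M`. Concatenation yields a largest event `A` on which `v` agrees with an element of
`M`, and its complement is not null. Among nonnull `B ⊆ Aᶜ`, choose one carrying a pointwise
orthonormal family in `M` of greatest possible length, which is at most `n`. On `B` every element of
`M` lies in the pointwise span of this family, since a residual nonzero on a nonnull part of `B`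
could be normalized to lengthen it (`hasOrthonormalFamilyOn_succ`). So the residual of `v`, cut off
to `B`, is orthogonal to `M`. It is nonzero: otherwise `v` would agree on `B` with an element of
`M`, against the maximality of `A` (`exists_maximal_indL0_smul_mem`). -/

theorem coeFn_smul_L0Vec (c : L0 P K) (x : L0Vec P K n) :
    ⇑(c • x) =ᵐ[P] fun ω => c ω • x ω :=
  AEEqFun.coeFn_comp₂ _ _ c x

/-- The arguments swap because Mathlib's inner product is conjugate-linear in its first slot. -/
theorem coeFn_innerL0 (x y : L0Vec P K n) :
    ⇑(innerL0 x y) =ᵐ[P] fun ω => ⟪y ω, x ω⟫_K :=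
  AEEqFun.coeFn_comp₂ _ _ x y

theorem coeFn_indL0_smul {A : Set Ω} (hA : MeasurableSet A) (x : L0Vec P K n) :
    ⇑(indL0 P K A hA • x) =ᵐ[P] A.indicator x := by
  filter_upwards [coeFn_smul_L0Vec (indL0 P K A hA) x,
    AEEqFun.coeFn_mk (A.indicator fun _ => (1 : K))
      (stronglyMeasurable_const.indicator hA).aestronglyMeasurable (μ := P)] with ω h₁ h₂
  rw [h₁]
  change (indL0 P K A hA) ω = _ at h₂
  rw [h₂]
  by_cases h : ω ∈ A <;> simp [h]

theorem coeFn_sum_L0Vec {ι : Type*} (s : Finset ι) (f : ι → L0Vec P K n) :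
    ⇑(∑ i ∈ s, f i) =ᵐ[P] fun ω => ∑ i ∈ s, f i ω := by
  classical
  induction s using Finset.induction_on with
  | empty =>
    simp only [Finset.sum_empty]
    exact AEEqFun.coeFn_zero
  | insert a s ha ih =>
    rw [Finset.sum_insert ha]
    filter_upwards [AEEqFun.coeFn_add (f a) (∑ i ∈ s, f i), ih] with ω h₁ h₂
    rw [h₁, Pi.add_apply, h₂, Finset.sum_insert ha]

/-! ### Pointwise Gram–Schmidt inside `M` -/

/-- The residual of `x` after subtracting its components along the family `y`. -/
def residual {k : ℕ} (y : Fin k → L0Vec P K n) (x : L0Vec P K n) : L0Vec P K n :=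
  x - ∑ j, innerL0 x (y j) • y j

theorem coeFn_residual {k : ℕ} (y : Fin k → L0Vec P K n) (x : L0Vec P K n) :
    ⇑(residual y x) =ᵐ[P] fun ω => x ω - ∑ j, ⟪y j ω, x ω⟫_K • y j ω := by
  have h₁ := ae_all_iff.2 fun j => coeFn_smul_L0Vec (innerL0 x (y j)) (y j)
  have h₂ := ae_all_iff.2 fun j => coeFn_innerL0 x (y j)
  filter_upwards [AEEqFun.coeFn_sub x (∑ j, innerL0 x (y j) • y j),
    coeFn_sum_L0Vec Finset.univ (fun j => innerL0 x (y j) • y j), h₁, h₂] with ω h₃ h₄ h₁ h₂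
  rw [residual, h₃, Pi.sub_apply, h₄]
  simp only [h₁, h₂]

theorem sum_smul_mem {k : ℕ} {M : Submodule (L0 P K) (L0Vec P K n)} {y : Fin k → L0Vec P K n}
    (hy : ∀ j, y j ∈ M) (x : L0Vec P K n) : ∑ j, innerL0 x (y j) • y j ∈ M :=
  M.sum_mem fun j _ => M.smul_mem _ (hy j)

theorem inner_sub_sum_of_orthonormal {E : Type*} [NormedAddCommGroup E] [InnerProductSpace K E]
    {k : ℕ} {y : Fin k → E} (hy : Orthonormal K y) (x : E) (i : Fin k) :
    ⟪y i, x - ∑ j, ⟪y j, x⟫_K • y j⟫_K = 0 := by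
  rw [inner_sub_right, hy.inner_right_fintype, sub_self]

/-- `M` contains a family of `k` elements that is pointwise orthonormal on `B`. -/
def HasOrthonormalFamilyOn (M : Submodule (L0 P K) (L0Vec P K n)) (k : ℕ) (B : Set Ω) : Prop :=
  ∃ y : Fin k → L0Vec P K n, (∀ j, y j ∈ M) ∧ ∀ᵐ ω ∂P, ω ∈ B → Orthonormal K fun j => y j ω

/-- A nonnull `B` contains a point at which the values are genuinely orthonormal in an
`n`-dimensional space. This bound makes a maximal length exist. -/
theorem HasOrthonormalFamilyOn.le {M : Submodule (L0 P K) (L0Vec P K n)} {k : ℕ} {B : Set Ω}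
    (h : HasOrthonormalFamilyOn M k B) (hB : P B ≠ 0) : k ≤ n := by
  obtain ⟨y, -, hy⟩ := h
  obtain ⟨ω, hω, hyω⟩ : ∃ ω ∈ B, Orthonormal K fun j => y j ω := by
    by_contra! hc
    refine hB (measure_mono_null (fun ω hω => ?_) (ae_iff.1 hy))
    simpa using ⟨hω, hc ω hω⟩
  simpa using hyω.linearIndependent.fintype_card_le_finrank

/-- Normalizing a nonvanishing residual extends an orthonormal family. -/
theorem hasOrthonormalFamilyOn_succ {M : Submodule (L0 P K) (L0Vec P K n)} {k : ℕ} {B : Set Ω}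
    {y : Fin k → L0Vec P K n} (hyM : ∀ j, y j ∈ M)
    (hy : ∀ᵐ ω ∂P, ω ∈ B → Orthonormal K fun j => y j ω) {x : L0Vec P K n} (hx : x ∈ M) :
    HasOrthonormalFamilyOn M (k + 1) (B ∩ {ω | residual y x ω ≠ 0}) := by
  set z := residual y x with hz
  have hzM : z ∈ M := M.sub_mem hx (sum_smul_mem hyM x)
  -- Since `0⁻¹ = 0`, the normalizing factor is defined and measurable also where `z` vanishes.
  have hm : AEStronglyMeasurable (fun ω => ((‖z ω‖⁻¹ : ℝ) : K)) P :=
    (RCLike.measurable_ofReal.comp z.stronglyMeasurable.norm.measurable.inv).aestronglyMeasurable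
  refine ⟨Matrix.vecCons ((AEEqFun.mk _ hm : L0 P K) • z) y, ?_, ?_⟩
  · intro j
    refine Fin.cases ?_ (fun j => ?_) j
    · exact M.smul_mem _ hzM
    · exact hyM j
  · filter_upwards [hy, coeFn_smul_L0Vec (AEEqFun.mk _ hm : L0 P K) z, AEEqFun.coeFn_mk _ hm,
      coeFn_residual y x] with ω hy h₁ h₂ h₃ hω
    have hyω := hy hω.1
    have hcons : (fun j => (Matrix.vecCons ((AEEqFun.mk _ hm : L0 P K) • z) y j) ω) =
        Matrix.vecCons (((‖z ω‖⁻¹ : ℝ) : K) • z ω) fun j => y j ω := by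
      funext j
      refine Fin.cases ?_ (fun j => ?_) j
      · simp only [Matrix.cons_val_zero]
        rw [h₁, h₂]
      · simp only [Matrix.cons_val_succ]
    rw [hcons, orthonormal_vecCons_iff]
    refine ⟨?_, fun i => ?_, hyω⟩
    · have : ‖z ω‖ ≠ 0 := norm_ne_zero_iff.2 hω.2
      rw [norm_smul, RCLike.norm_ofReal, abs_of_nonneg (by positivity), inv_mul_cancel₀ this]
    · rw [inner_smul_left, ← inner_conj_symm, hz, h₃, inner_sub_sum_of_orthonormal hyω]
      simp

/-! ### Gluing and the largest event -/

theorem indL0_smul_iUnion_mem {M : Submodule (L0 P K) (L0Vec P K n)}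
    (hM : HasCountableConcatenation (P := P) (K := K) (M : Set (L0Vec P K n)))
    {v : L0Vec P K n} {A : ℕ → Set Ω} (hA : ∀ k, MeasurableSet (A k))
    (hv : ∀ k, indL0 P K (A k) (hA k) • v ∈ M) :
    indL0 P K (⋃ k, A k) (MeasurableSet.iUnion hA) • v ∈ M := by
  -- The `A k` may overlap and need not cover `Ω`. Index `0` is given the complement of their union,
  -- with value `0`, and `disjointed` then produces a partition.
  let C : ℕ → Set Ω := fun k => Nat.casesOn k (⋃ k, A k)ᶜ A
  let x : ℕ → L0Vec P K n := fun k => Nat.casesOn k 0 fun k => indL0 P K (A k) (hA k) • v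
  have hC : ∀ k, MeasurableSet (C k) := by
    rintro (_ | k)
    · exact (MeasurableSet.iUnion hA).compl
    · exact hA k
  have hCU : ⋃ k, disjointed C k = Set.univ := by
    rw [iUnion_disjointed, Set.eq_univ_iff_forall]
    intro ω
    by_cases h : ω ∈ ⋃ k, A k
    · obtain ⟨k, hk⟩ := Set.mem_iUnion.1 h
      exact Set.mem_iUnion.2 ⟨k + 1, hk⟩
    · exact Set.mem_iUnion.2 ⟨0, h⟩
  have hx : ∀ k, x k ∈ (M : Set (L0Vec P K n)) := by
    rintro (_ | k)
    · exact M.zero_mem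
    · exact hv k
  obtain ⟨z, hzM, hz⟩ := hM (disjointed C) (fun k => MeasurableSet.disjointed hC k)
    (disjoint_disjointed C) hCU x hx
  suffices h : indL0 P K (⋃ k, A k) (MeasurableSet.iUnion hA) • v = z by rw [h]; exact hzM
  refine AEEqFun.ext ?_
  have h₁ := ae_all_iff.2 fun k => coeFn_indL0_smul (P := P) (MeasurableSet.disjointed hC k) z
  have h₂ := ae_all_iff.2 fun k => coeFn_indL0_smul (P := P) (MeasurableSet.disjointed hC k) (x k)
  have h₃ := ae_all_iff.2 fun k => coeFn_indL0_smul (P := P) (hA k) v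
  filter_upwards [h₁, h₂, h₃, coeFn_indL0_smul (P := P) (MeasurableSet.iUnion hA) v,
    AEEqFun.coeFn_zero (α := Ω) (μ := P) (β := EuclideanSpace K (Fin n))] with ω h₁ h₂ h₃ h₄ h₅
  rw [h₄]
  obtain ⟨k, hk⟩ := Set.mem_iUnion.1 (hCU ▸ Set.mem_univ ω : ω ∈ ⋃ k, disjointed C k)
  have hzx : z ω = x k ω := by
    have h := h₁ k
    rw [hz k, h₂ k, Set.indicator_of_mem hk, Set.indicator_of_mem hk] at h
    exact h.symm
  have hkC : ω ∈ C k := disjointed_subset C k hk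
  rw [hzx]
  cases k with
  | zero => exact (Set.indicator_of_notMem hkC _).trans h₅.symm
  | succ k =>
    have hkA : ω ∈ A k := hkC
    exact (Set.indicator_of_mem (Set.mem_iUnion.2 ⟨k, hkA⟩) _).trans
      ((Set.indicator_of_mem hkA _).symm.trans (h₃ k).symm)

theorem indL0_smul_union {A B : Set Ω} (hA : MeasurableSet A) (hB : MeasurableSet B)
    (hAB : Disjoint A B) (v : L0Vec P K n) :
    indL0 P K (A ∪ B) (hA.union hB) • v = indL0 P K A hA • v + indL0 P K B hB • v := by
  refine AEEqFun.ext ?_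
  filter_upwards [coeFn_indL0_smul (P := P) (hA.union hB) v, coeFn_indL0_smul (P := P) hA v,
    coeFn_indL0_smul (P := P) hB v,
    AEEqFun.coeFn_add (indL0 P K A hA • v) (indL0 P K B hB • v)] with ω h₁ h₂ h₃ h₄
  rw [h₁, h₄, Pi.add_apply, h₂, h₃, Set.indicator_union_of_disjoint hAB]

/-- There is a largest event on which the localization of `v` lies in `M`. -/
theorem exists_maximal_indL0_smul_mem [IsFiniteMeasure P]
    {M : Submodule (L0 P K) (L0Vec P K n)}
    (hM : HasCountableConcatenation (P := P) (K := K) (M : Set (L0Vec P K n)))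
    (v : L0Vec P K n) :
    ∃ (A : Set Ω) (hA : MeasurableSet A), indL0 P K A hA • v ∈ M ∧
      ∀ (B : Set Ω) (hB : MeasurableSet B), Disjoint A B → indL0 P K B hB • v ∈ M → P B = 0 := by
  let S : Set ENNReal :=
    {r | ∃ (A : Set Ω) (hA : MeasurableSet A), indL0 P K A hA • v ∈ M ∧ P A = r}
  have hne : S.Nonempty := by
    refine ⟨0, ∅, MeasurableSet.empty, ?_, measure_empty⟩
    have : indL0 P K ∅ MeasurableSet.empty • v = 0 := by
      refine AEEqFun.ext ?_
      filter_upwards [coeFn_indL0_smul (P := P) MeasurableSet.empty v,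
        AEEqFun.coeFn_zero (α := Ω) (μ := P) (β := EuclideanSpace K (Fin n))] with ω h₁ h₂
      rw [h₁, h₂]
      simp
    rw [this]
    exact M.zero_mem
  obtain ⟨u, -, hu, huS⟩ := exists_seq_tendsto_sSup hne (OrderTop.bddAbove S)
  choose A hA hAM hAu using huS
  have hU := indL0_smul_iUnion_mem hM hA hAM
  refine ⟨⋃ k, A k, MeasurableSet.iUnion hA, hU, fun B hB hd hBM => ?_⟩
  -- The union of a maximizing sequence attains the supremum, so adjoining a disjoint nonnull event
  -- would exceed it; finiteness of `P` makes this strict.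
  have hsup : sSup S ≤ P (⋃ k, A k) :=
    le_of_tendsto' hu fun k => hAu k ▸ measure_mono (Set.subset_iUnion A k)
  have hle : P ((⋃ k, A k) ∪ B) ≤ sSup S := by
    refine le_sSup ⟨_, (MeasurableSet.iUnion hA).union hB, ?_, rfl⟩
    rw [indL0_smul_union (MeasurableSet.iUnion hA) hB hd]
    exact M.add_mem hU hBM
  rw [measure_union hd hB] at hle
  have h := hle.trans hsup
  by_contra h0
  exact absurd h (not_le.2 (ENNReal.lt_add_right (measure_ne_top P _) h0))

/-! ### Construction of the orthogonal element -/

/-- A proper submodule with the countable concatenation property has a nonzero element in its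
orthogonal complement. -/
theorem exists_ne_zero_forall_innerL0_eq_zero [IsFiniteMeasure P]
    {M : Submodule (L0 P K) (L0Vec P K n)} (hproper : M ≠ ⊤)
    (hM : HasCountableConcatenation (P := P) (K := K) (M : Set (L0Vec P K n))) :
    ∃ x : L0Vec P K n, x ≠ 0 ∧ ∀ y ∈ M, innerL0 x y = 0 := by
  classical
  obtain ⟨v, hv⟩ : ∃ v, v ∉ M := by
    by_contra! h
    exact hproper (eq_top_iff.2 fun v _ => h v)
  obtain ⟨A, hA, hAM, hmax⟩ := exists_maximal_indL0_smul_mem hM v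
  have hAc : P Aᶜ ≠ 0 := by
    intro h0
    apply hv
    suffices h : indL0 P K A hA • v = v by rwa [h] at hAM
    refine AEEqFun.ext ?_
    filter_upwards [coeFn_indL0_smul (P := P) hA v, measure_eq_zero_iff_ae_notMem.1 h0] with ω h₁ h₂
    rw [h₁, Set.indicator_of_mem (by simpa using h₂)]
  let Q : ℕ → Prop := fun k =>
    ∃ B ⊆ Aᶜ, MeasurableSet B ∧ P B ≠ 0 ∧ HasOrthonormalFamilyOn M k B
  -- The empty family is vacuously orthonormal on all of `Aᶜ`.
  have hQ0 : Q 0 := ⟨Aᶜ, subset_rfl, hA.compl, hAc, Fin.elim0, fun j => j.elim0,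
    ae_of_all _ fun ω _ => ⟨fun j => j.elim0, fun j => j.elim0⟩⟩
  have hQle : ∀ k, Q k → k ≤ n := fun k ⟨B, _, _, hB, h⟩ => h.le hB
  obtain ⟨k, ⟨B, hBA, hBm, hB, y, hyM, hy⟩, hk⟩ : ∃ k, Q k ∧ ¬ Q (k + 1) := by
    refine ⟨Nat.findGreatest Q n, Nat.findGreatest_spec (Nat.zero_le n) hQ0, fun hQ => ?_⟩
    exact absurd (Nat.le_findGreatest (hQle _ hQ) hQ) (Nat.not_succ_le_self _)
  have hres : ∀ x ∈ M, ∀ᵐ ω ∂P, ω ∈ B → residual y x ω = 0 := by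
    intro x hx
    by_contra hne
    refine hk ⟨B ∩ {ω | residual y x ω ≠ 0}, Set.inter_subset_left.trans hBA,
      hBm.inter (residual y x).stronglyMeasurable.measurableSet_support, fun h0 => hne ?_,
      hasOrthonormalFamilyOn_succ hyM hy hx⟩
    filter_upwards [measure_eq_zero_iff_ae_notMem.1 h0] with ω hω hωB
    by_contra hz
    exact hω ⟨hωB, hz⟩
  refine ⟨indL0 P K B hBm • residual y v, fun h0 => ?_, fun x hx => ?_⟩
  · refine hB (hmax B hBm (Set.disjoint_right.2 fun ω hω => hBA hω) ?_)
    -- If the cut-off residual is zero, only the projection of `v` survives on `B`, and that lies in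
    -- `M`.
    have hsplit : indL0 P K B hBm • v =
        indL0 P K B hBm • residual y v + indL0 P K B hBm • ∑ j, innerL0 v (y j) • y j := by
      refine Eq.trans ?_
        (smul_add (indL0 P K B hBm) (residual y v) (∑ j, innerL0 v (y j) • y j))
      rw [residual, sub_add_cancel]
    rw [hsplit, h0, zero_add]
    exact M.smul_mem _ (sum_smul_mem hyM v)
  · refine AEEqFun.ext ?_
    filter_upwards [coeFn_innerL0 (indL0 P K B hBm • residual y v) x,
      coeFn_indL0_smul hBm (residual y v), coeFn_residual y v, coeFn_residual y x, hres x hx, hy,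
      AEEqFun.coeFn_zero (α := Ω) (μ := P) (β := K)] with ω h₁ h₂ h₃ h₄ h₅ h₆ h₇
    rw [h₁, h₂, h₇]
    by_cases hω : ω ∈ B
    · have hxω := sub_eq_zero.1 (h₄.symm.trans (h₅ hω))
      rw [Set.indicator_of_mem hω, h₃, hxω, sum_inner]
      refine Finset.sum_eq_zero fun j _ => ?_
      rw [inner_smul_left, inner_sub_sum_of_orthonormal (h₆ hω), mul_zero]
    · rw [Set.indicator_of_notMem hω, inner_zero_right, Pi.zero_apply]

end RandomModule

theorem mainTheorem4 {Ω : Type*} [MeasurableSpace Ω] (P : Measure Ω) [IsProbabilityMeasure P]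
    {K : Type*} [RCLike K] (n : ℕ)
    (M : Submodule (RandomModule.L0 P K) (RandomModule.L0Vec P K n))
    (hproper : M ≠ ⊤)
    (hM : RandomModule.HasCountableConcatenation (P := P) (K := K)
      (M : Set (RandomModule.L0Vec P K n))) :
    ∃ x : RandomModule.L0Vec P K n, x ≠ 0 ∧ ∀ y ∈ M, RandomModule.innerL0 x y = 0 :=
  RandomModule.exists_ne_zero_forall_innerL0_eq_zero hproper hM
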